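/- Let $\{0,1\}^{\mathbb N}$ be the Cantor space with the compatible metric $d(\sigma,\sigma)=0$ and $d(\sigma,\tau)=1/n$ for $\sigma\neq\tau$, where $n$ is the least positive integer with $\sigma(n)\neq\tau(n)$. Let $\mathcal C(\{0,1\}^{\mathbb N})$ be the space of all continuous maps $f:\{0,1\}^{\mathbb N}\to\{0,1\}^{\mathbb N}$ with the metric $\tilde d(f,g)=\max_x d(f(x),g(x))$. Let $\mathcal M(\{0,1\}^{\mathbb N})$ be the space of all Borel probability measures on $\{0,1\}^{\mathbb N}$ with the Prohorov metric $$d_P(\mu,\nu)=\inf\{\delta>0:\ \mu(X)\le\nu(X^\delta)+\delta\ \text{ and }\ \nu(X)\le\mu(X^\delta)+\delta\ \text{ for every Borel set } X\},\qquad X^\delta=\{x: d(x,X)<\delta\}.$$ For $f\in\mathcal C(\{0,1\}^{\mathbb N})$ let $\tilde f:\mathcal M(\{0,1\}^{\mathbb N})\to\mathcal M(\{0,1\}^{\mathbb N})$ be the induced map $(\tilde f(\mu))(X)=\mu(f^{-1}(X))$. For a continuous self-map $T$ of a compact metric space $(Y,\rho)$, let $$\operatorname{ent}(T)=\lim_{\epsilon\to0^+}\Big(\limsup_{n\to\infty}\frac1n\log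 N(n,\epsilon,T)\Big),$$ where $N(n,\epsilon,T)$ is the maximum cardinality of a set $A\subset Y$ such that $\max_{0\le k<n}\rho(T^k(x),T^k(y))\ge\epsilon$ for all distinct $x,y\in A$. Then for the generic $f\in\mathcal C(\{0,1\}^{\mathbb N})$ the induced map $\tilde f$ has zero topological entropy; that is, the set $$\{f\in\mathcal C(\{0,1\}^{\mathbb N}):\ \operatorname{ent}(\tilde f)\neq0\}$$ is of the first category in $\mathcal C(\{0,1\}^{\mathbb N})$. -/

import Mathlib

open MeasureTheory Filter Topology

noncomputable section

namespace CantorEntropy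

/-! ### The Cantor space -/

/-- The Cantor space `{0,1}^ℕ`, the set of all sequences of zeros and ones. -/
def CantorSpace : Type := ℕ → Bool

namespace CantorSpace

/-- The product topology, each factor `{0,1}` being discrete. -/
instance : TopologicalSpace CantorSpace := inferInstanceAs (TopologicalSpace (ℕ → Bool))

instance : CompactSpace CantorSpace := inferInstanceAs (CompactSpace (ℕ → Bool))

open Classical in
/-- `d(σ,σ) = 0` and, for `σ ≠ τ`, `d(σ,τ) = 1/n`, where the `n`-th coordinate is the first one in
which `σ` and `τ` differ. The coordinates of `ℕ → Bool` are numbered from `0`, those of the formula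
from `1`, whence the shift by one. -/
protected def dist (σ τ : CantorSpace) : ℝ :=
  if σ = τ then 0 else 1 / ((PiNat.firstDiff (E := fun _ => Bool) σ τ : ℝ) + 1)

protected theorem dist_self (σ : CantorSpace) : CantorSpace.dist σ σ = 0 := by
  simp [CantorSpace.dist]

protected theorem dist_of_ne {σ τ : CantorSpace} (h : σ ≠ τ) :
    CantorSpace.dist σ τ = 1 / ((PiNat.firstDiff (E := fun _ => Bool) σ τ : ℝ) + 1) := by
  simp [CantorSpace.dist, h]

protected theorem dist_nonneg (σ τ : CantorSpace) : 0 ≤ CantorSpace.dist σ τ := by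
  rcases eq_or_ne σ τ with rfl | h
  · rw [CantorSpace.dist_self]
  · rw [CantorSpace.dist_of_ne h]; positivity

protected theorem dist_comm (σ τ : CantorSpace) :
    CantorSpace.dist σ τ = CantorSpace.dist τ σ := by
  rcases eq_or_ne σ τ with rfl | h
  · rfl
  · have key : PiNat.firstDiff (E := fun _ => Bool) σ τ = PiNat.firstDiff (E := fun _ => Bool) τ σ :=
      PiNat.firstDiff_comm _ _
    rw [CantorSpace.dist_of_ne h, CantorSpace.dist_of_ne h.symm, key]

protected theorem dist_triangle (σ τ ρ : CantorSpace) :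
    CantorSpace.dist σ ρ ≤ CantorSpace.dist σ τ + CantorSpace.dist τ ρ := by
  have h1 := CantorSpace.dist_nonneg σ τ
  have h2 := CantorSpace.dist_nonneg τ ρ
  rcases eq_or_ne σ ρ with rfl | hσρ
  · rw [CantorSpace.dist_self]; linarith
  rcases eq_or_ne σ τ with rfl | hστ
  · linarith
  rcases eq_or_ne τ ρ with rfl | hτρ
  · linarith
  rcases min_le_iff.1 (PiNat.min_firstDiff_le (E := fun _ => Bool) σ τ ρ hσρ) with h | h
  · have : CantorSpace.dist σ ρ ≤ CantorSpace.dist σ τ := by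
      rw [CantorSpace.dist_of_ne hσρ, CantorSpace.dist_of_ne hστ]
      gcongr
    linarith
  · have : CantorSpace.dist σ ρ ≤ CantorSpace.dist τ ρ := by
      rw [CantorSpace.dist_of_ne hσρ, CantorSpace.dist_of_ne hτρ]
      gcongr
    linarith

protected theorem eq_of_dist_eq_zero (σ τ : CantorSpace) (h : CantorSpace.dist σ τ = 0) :
    σ = τ := by
  by_contra hne
  rw [CantorSpace.dist_of_ne hne] at h
  have : (0 : ℝ) < 1 / ((PiNat.firstDiff (E := fun _ => Bool) σ τ : ℝ) + 1) := by positivity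
  linarith

/-- The distance is compatible with the product topology. -/
protected theorem isOpen_iff_dist (s : Set CantorSpace) :
    IsOpen s ↔ ∀ σ ∈ s, ∃ ε > 0, ∀ τ, CantorSpace.dist σ τ < ε → τ ∈ s := by
  have key := PiNat.isOpen_iff_dist (E := fun _ => Bool) s
  refine key.trans (forall₂_congr fun σ _ => ?_)
  constructor
  · rintro ⟨ε, hε, H⟩
    obtain ⟨n, hn⟩ := exists_pow_lt_of_lt_one hε (by norm_num : (1 / 2 : ℝ) < 1)
    refine ⟨1 / ((n : ℝ) + 1), by positivity, fun τ hτ => ?_⟩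
    rcases eq_or_ne σ τ with rfl | hne
    · exact H σ (by rw [PiNat.dist_self]; exact hε)
    · rw [CantorSpace.dist_of_ne hne] at hτ
      have h1 : (n : ℝ) + 1 < (PiNat.firstDiff (E := fun _ => Bool) σ τ : ℝ) + 1 :=
        (one_div_lt_one_div (by positivity) (by positivity)).1 hτ
      have h2 : n ≤ PiNat.firstDiff (E := fun _ => Bool) σ τ := by
        have : (n : ℝ) < (PiNat.firstDiff (E := fun _ => Bool) σ τ : ℝ) := by linarith
        exact_mod_cast this.le
      refine H τ ?_
      rw [PiNat.dist_eq_of_ne (E := fun _ => Bool) hne]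
      exact (pow_le_pow_of_le_one (by norm_num) (by norm_num) h2).trans_lt hn
  · rintro ⟨ε, hε, H⟩
    obtain ⟨n, hn⟩ := exists_nat_one_div_lt hε
    refine ⟨(1 / 2) ^ n, by positivity, fun τ hτ => ?_⟩
    rcases eq_or_ne σ τ with rfl | hne
    · exact H σ ((CantorSpace.dist_self σ).trans_lt hε)
    · rw [PiNat.dist_eq_of_ne (E := fun _ => Bool) hne] at hτ
      have h2 : n < PiNat.firstDiff (E := fun _ => Bool) σ τ :=
        (pow_lt_pow_iff_right_of_lt_one₀ (by norm_num) (by norm_num)).1 hτ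
      refine H τ ?_
      rw [CantorSpace.dist_of_ne hne]
      refine lt_of_le_of_lt ?_ hn
      gcongr

/-- The Cantor space as a metric space; its topology is the product topology by construction. -/
instance : MetricSpace CantorSpace :=
  letI : Dist CantorSpace := ⟨CantorSpace.dist⟩
  MetricSpace.ofDistTopology CantorSpace.dist CantorSpace.dist_self CantorSpace.dist_comm
    CantorSpace.dist_triangle CantorSpace.isOpen_iff_dist CantorSpace.eq_of_dist_eq_zero

/-- The Borel σ-algebra of the Cantor space. -/
instance : MeasurableSpace CantorSpace := borel CantorSpace

instance : BorelSpace CantorSpace := ⟨rfl⟩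

end CantorSpace

/-! ### The induced map on probability measures -/

/-- The space `𝓜(M)` of all Borel probability measures on `M`, with the Prohorov metric. -/
abbrev ProhorovSpace (M : Type*) [MeasurableSpace M] : Type _ :=
  LevyProkhorov (ProbabilityMeasure M)

/-- The map `𝓜(M) → 𝓜(M)` induced by a continuous map `f : M → M`: it sends `μ` to the
push-forward measure `X ↦ μ (f⁻¹(X))`. -/
def inducedMap {M : Type*} [TopologicalSpace M] [MeasurableSpace M] [BorelSpace M]
    (f : C(M, M)) (μ : ProhorovSpace M) : ProhorovSpace M :=
  LevyProkhorov.ofMeasure (μ.toMeasure.map f.continuous.measurable.aemeasurable)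

/-! ### Topological entropy -/

section Entropy

variable {X : Type*} [MetricSpace X]

/-- The metric `d_n(x,y) = max_{0 ≤ k < n} d(T^k x, T^k y)` (used for `n ≥ 1`). -/
def dynDist (T : X → X) (n : ℕ) (x y : X) : ℝ :=
  ⨆ k : Fin n, dist (T^[k] x) (T^[k] y)

/-- `A` is `(n,ε,T)`-separated: distinct points of `A` have `d_n`-distance at least `ε`. -/
def IsSeparatedSet (T : X → X) (n : ℕ) (ε : ℝ) (A : Set X) : Prop :=
  ∀ x ∈ A, ∀ y ∈ A, x ≠ y → ε ≤ dynDist T n x y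

/-- The maximum cardinality `N(n,ε,T)` of an `(n,ε,T)`-separated set (`⊤` if there is no bound,
which does not happen for continuous maps of compact spaces). -/
def maxSeparated (T : X → X) (n : ℕ) (ε : ℝ) : ℕ∞ :=
  ⨆ A : {A : Set X // IsSeparatedSet T n ε A}, A.1.encard

/-- `limsup_{n → ∞} (1/n) log N(n,ε,T)`. -/
def separatedGrowth (T : X → X) (ε : ℝ) : EReal :=
  limsup (fun n : ℕ => ENNReal.log (maxSeparated T n ε : ENNReal) / (n : EReal)) atTop

/-- The topological entropy
`ent(T) = lim_{ε → 0⁺} (limsup_{n → ∞} (1/n) log N(n,ε,T))`, an element of `[0,∞]`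
when `X` is nonempty. The limit always exists, see `tendsto_topEntropy`. -/
def topEntropy (T : X → X) : EReal :=
  limUnder (𝓝[>] (0 : ℝ)) (separatedGrowth T)

theorem separatedGrowth_antitone (T : X → X) : Antitone (separatedGrowth T) := by
  intro ε ε' h
  refine limsup_le_limsup (Eventually.of_forall fun n => ?_)
  refine EReal.div_le_div_right_of_nonneg (by positivity) (ENNReal.log_monotone ?_)
  refine ENat.toENNReal_mono (iSup_le fun A => ?_)
  exact le_iSup (fun B : {B : Set X // IsSeparatedSet T n ε B} => B.1.encard)
    ⟨A.1, fun x hx y hy hxy => h.trans (A.2 x hx y hy hxy)⟩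

/-- The limit that defines the topological entropy exists. -/
theorem tendsto_topEntropy (T : X → X) :
    Tendsto (separatedGrowth T) (𝓝[>] (0 : ℝ)) (𝓝 (topEntropy T)) :=
  tendsto_nhds_limUnder
    ⟨_, Monotone.tendsto_nhdsGT (β := ERealᵒᵈ) (separatedGrowth_antitone T).dual_right 0⟩

end Entropy

end CantorEntropy

end

open MeasureTheory Filter Topology

namespace CantorEntropy

namespace CantorSpace

/-! A generic `f` maps, for infinitely many `m`, every cylinder of length `m` into a cylinder of
length `m`: for fixed `m` this is an open condition, and having it for some `m > n` is dense
(`residual_preservesInitialSegments`). Such a map moves these cylinders as blocks, so at scale `1 /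
m` the whole orbit of a measure is governed by its finitely many cylinder masses. Rounding these
masses sorts all measures into finitely many classes, and measures in one class stay `1 / m`-close
forever. Hence separated sets are bounded independently of `n`
(`exists_maxSeparated_inducedMap_le`), and the growth rate is zero. -/

/-- The first `m` coordinates of a point of the Cantor space. -/
def initialSegment (m : ℕ) (x : CantorSpace) : Fin m → Bool := fun i => x i

theorem continuous_initialSegment (m : ℕ) : Continuous (initialSegment m) := by
  refine continuous_pi fun i => ?_
  exact continuous_apply (A := fun _ : ℕ => Bool) (i : ℕ)

theorem dist_lt_iff_initialSegment_eq {m : ℕ} (hm : m ≠ 0) {x y : CantorSpace} :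
    dist x y < 1 / (m : ℝ) ↔ initialSegment m x = initialSegment m y := by
  have hm' : (0 : ℝ) < m := by positivity
  rcases eq_or_ne x y with rfl | h
  · simpa using Nat.pos_of_ne_zero hm
  · have hd : dist x y = 1 / ((PiNat.firstDiff (E := fun _ => Bool) x y : ℝ) + 1) :=
      CantorSpace.dist_of_ne h
    rw [hd, one_div_lt_one_div (by positivity) hm']
    constructor
    · intro hlt
      have hlt' : m < PiNat.firstDiff (E := fun _ => Bool) x y + 1 := by exact_mod_cast hlt
      funext i
      exact PiNat.apply_eq_of_lt_firstDiff (E := fun _ => Bool) (by omega)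
    · intro heq
      have hle : m ≤ PiNat.firstDiff (E := fun _ => Bool) x y := by
        by_contra! hlt
        exact PiNat.apply_firstDiff_ne (E := fun _ => Bool) h (congrFun heq ⟨_, hlt⟩)
      exact_mod_cast Nat.lt_succ_of_le hle

/-- The extension of a finite sequence by zeros. -/
def extend (m : ℕ) (v : Fin m → Bool) : CantorSpace :=
  fun i => if h : i < m then v ⟨i, h⟩ else false

theorem initialSegment_extend (m : ℕ) (v : Fin m → Bool) :
    initialSegment m (extend m v) = v := by
  funext i
  simp [initialSegment, extend]

end CantorSpace

open CantorSpace

/-! ### Generic maps preserve arbitrarily long initial segments -/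

/-- The first `m` coordinates of the image under `f` depend on the first `m` coordinates only. -/
def PreservesInitialSegments (m : ℕ) (f : CantorSpace → CantorSpace) : Prop :=
  ∀ x y, initialSegment m x = initialSegment m y → initialSegment m (f x) = initialSegment m (f y)

theorem PreservesInitialSegments.iterate {m : ℕ} {f : CantorSpace → CantorSpace}
    (hf : PreservesInitialSegments m f) (k : ℕ) : PreservesInitialSegments m f^[k] := by
  induction k with
  | zero => exact fun _ _ h => h
  | succ k ih =>
    intro x y h
    rw [Function.iterate_succ_apply', Function.iterate_succ_apply']
    exact hf _ _ (ih x y h)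

/-- A map within `1 / m` of `f` has the same first `m` output coordinates as `f` at every point. -/
theorem isOpen_setOf_preservesInitialSegments {m : ℕ} (hm : m ≠ 0) :
    IsOpen {f : C(CantorSpace, CantorSpace) | PreservesInitialSegments m f} := by
  refine Metric.isOpen_iff.2 fun f hf => ⟨1 / (m : ℝ), by positivity, fun g hg x y hxy => ?_⟩
  have hfg : ∀ z, initialSegment m (g z) = initialSegment m (f z) := fun z =>
    (dist_lt_iff_initialSegment_eq hm).1
      ((ContinuousMap.dist_apply_le_dist z).trans_lt hg)
  rw [hfg, hfg]
  exact hf x y hxy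

/-- Truncating the input to `m` coordinates before applying `f` changes `f` little, by uniform
continuity, and makes the entire output depend on those coordinates only. -/
theorem dense_setOf_preservesInitialSegments (n : ℕ) :
    Dense {f : C(CantorSpace, CantorSpace) | ∃ m > n, PreservesInitialSegments m f} := by
  refine Metric.dense_iff.2 fun f ε hε => ?_
  obtain ⟨δ, hδ, hfδ⟩ := Metric.uniformContinuous_iff.1
    (CompactSpace.uniformContinuous_of_continuous f.continuous) ε hε
  obtain ⟨k, hk⟩ := exists_nat_one_div_lt hδ
  -- Large enough for both `m > n` and `1 / m ≤ 1 / (k + 1) < δ`.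
  set m := n + k + 1 with hm
  have hmδ : 1 / (m : ℝ) < δ := by
    refine lt_of_le_of_lt (one_div_le_one_div_of_le (by positivity) ?_) hk
    rw [hm]; push_cast; linarith [(Nat.cast_nonneg n : (0 : ℝ) ≤ n)]
  let g : C(CantorSpace, CantorSpace) :=
    ⟨fun x => f (extend m (initialSegment m x)),
      (continuous_of_discreteTopology (f := fun v => f (extend m v))).comp
        (continuous_initialSegment m)⟩
  refine ⟨g, ?_, m, by omega, fun x y hxy => ?_⟩
  · refine (ContinuousMap.dist_lt_iff hε).2 fun x => hfδ ?_
    exact ((dist_lt_iff_initialSegment_eq (by omega)).2 (initialSegment_extend m _)).trans hmδ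
  · change initialSegment m (f _) = initialSegment m (f _)
    rw [hxy]

theorem residual_preservesInitialSegments :
    {f : C(CantorSpace, CantorSpace) | ∀ n, ∃ m > n, PreservesInitialSegments m f} ∈
      residual C(CantorSpace, CantorSpace) := by
  rw [Set.ofPred_forall]
  refine countable_iInter_mem.2 fun n => residual_of_dense_open ?_
    (dense_setOf_preservesInitialSegments n)
  have : {f : C(CantorSpace, CantorSpace) | ∃ m > n, PreservesInitialSegments m f} =
      ⋃ m, ⋃ (_ : m > n),
        {f : C(CantorSpace, CantorSpace) | PreservesInitialSegments m f} := by
    ext f; simp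
  rw [this]
  exact isOpen_iUnion fun m => isOpen_iUnion fun hm =>
    isOpen_setOf_preservesInitialSegments (by omega)

/-! ### Orbits of measures under the induced map -/

theorem inducedMap_iterate_toMeasure {M : Type*} [TopologicalSpace M] [MeasurableSpace M]
    [BorelSpace M] (f : C(M, M)) (k : ℕ) (μ : ProhorovSpace M) :
    (((inducedMap f)^[k] μ).toMeasure : Measure M) = (μ.toMeasure : Measure M).map f^[k] := by
  induction k with
  | zero => simp
  | succ k ih =>
    rw [Function.iterate_succ_apply', Function.iterate_succ', ← Measure.map_map
      f.continuous.measurable (f.continuous.iterate k).measurable, ← ih]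
    rfl

theorem measure_preimage_le_of_forall_singleton {Ω ι : Type*} [MeasurableSpace Ω] [Fintype ι]
    [MeasurableSpace ι] [MeasurableSingletonClass ι] {π : Ω → ι} (hπ : Measurable π)
    {μ ν : Measure Ω} [IsFiniteMeasure μ] [IsFiniteMeasure ν] {η : ℝ}
    (h : ∀ i, μ.real (π ⁻¹' {i}) ≤ ν.real (π ⁻¹' {i}) + η) (hη : 0 ≤ η) (S : Set ι) :
    μ.real (π ⁻¹' S) ≤ ν.real (π ⁻¹' S) + Fintype.card ι * η := by
  classical
  have key : ∀ (κ : Measure Ω) [IsFiniteMeasure κ],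
      κ.real (π ⁻¹' S) = ∑ i ∈ S.toFinset, κ.real (π ⁻¹' {i}) := by
    intro κ _
    rw [sum_measureReal_preimage_singleton _ fun i _ => hπ (measurableSet_singleton i)]
    simp
  rw [key, key]
  calc ∑ i ∈ S.toFinset, μ.real (π ⁻¹' {i})
      ≤ ∑ i ∈ S.toFinset, (ν.real (π ⁻¹' {i}) + η) := Finset.sum_le_sum fun i _ => h i
    _ = ∑ i ∈ S.toFinset, ν.real (π ⁻¹' {i}) + S.toFinset.card * η := by
      rw [Finset.sum_add_distrib, Finset.sum_const, nsmul_eq_mul]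
    _ ≤ _ := by gcongr; exact Finset.card_le_univ _

/-- If `f` preserves initial segments of length `m`, then two measures that nearly agree on the
cylinders of length `m` stay `1 / m`-close along their whole orbits. -/
theorem dist_inducedMap_iterate_le {m : ℕ} (hm : m ≠ 0) {f : C(CantorSpace, CantorSpace)}
    (hf : PreservesInitialSegments m f) {μ ν : ProhorovSpace CantorSpace} {η : ℝ} (hη : 0 ≤ η)
    (hηm : Fintype.card (Fin m → Bool) * η ≤ 1 / (m : ℝ))
    (h : ∀ v, (μ.toMeasure : Measure CantorSpace).real (initialSegment m ⁻¹' {v}) ≤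
      (ν.toMeasure : Measure CantorSpace).real (initialSegment m ⁻¹' {v}) + η) (k : ℕ) :
    dist ((inducedMap f)^[k] μ) ((inducedMap f)^[k] ν) ≤ 1 / (m : ℝ) := by
  have hfk : Measurable f^[k] := (f.continuous.iterate k).measurable
  rw [LevyProkhorov.dist_probabilityMeasure_def]
  -- One of the two Prohorov inequalities suffices: the measures have equal total mass, so the other
  -- follows by passing to complements.
  refine levyProkhorovDist_le_of_forall_le _ _ (by positivity) fun ε B hε hB => ?_
  have hT : MeasurableSet (Metric.thickening ε B) := Metric.isOpen_thickening.measurableSet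
  have hε0 : 0 ≤ ε := le_trans (by positivity) hε.le
  rw [inducedMap_iterate_toMeasure, inducedMap_iterate_toMeasure, Measure.map_apply hfk hB,
    Measure.map_apply hfk hT]
  -- The cylinders that meet `f^[k] ⁻¹' B`: each is carried by `f^[k]` into the `ε`-neighbourhood of
  -- `B`, since its image has diameter below `1 / m`.
  set S := initialSegment m '' (f^[k] ⁻¹' B)
  have h1 : f^[k] ⁻¹' B ⊆ initialSegment m ⁻¹' S := Set.subset_preimage_image _ _
  have h2 : initialSegment m ⁻¹' S ⊆ f^[k] ⁻¹' Metric.thickening ε B := by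
    rintro x ⟨y, hy, hyx⟩
    refine Metric.mem_thickening_iff.2 ⟨f^[k] y, hy, ?_⟩
    exact ((dist_lt_iff_initialSegment_eq hm).2 (hf.iterate k _ _ hyx.symm)).trans hε
  have h3 := measure_preimage_le_of_forall_singleton
    (continuous_initialSegment m).measurable h hη S
  refine (measure_mono h1).trans (le_trans ?_ (add_le_add (measure_mono h2) le_rfl))
  rw [← ofReal_measureReal, ← ofReal_measureReal, ← ENNReal.ofReal_add measureReal_nonneg hε0]
  exact ENNReal.ofReal_le_ofReal (by linarith)

theorem exists_maxSeparated_inducedMap_le {f : C(CantorSpace, CantorSpace)}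
    (hf : ∀ n, ∃ m > n, PreservesInitialSegments m f) {ε : ℝ} (hε : 0 < ε) :
    ∃ C : ℕ, ∀ n, maxSeparated (inducedMap f) n ε ≤ C := by
  obtain ⟨j, hj⟩ := exists_nat_one_div_lt hε
  obtain ⟨m, hjm, hm⟩ := hf j
  have hm0 : m ≠ 0 := by omega
  have hmε : 1 / (m : ℝ) < ε := by
    refine lt_of_le_of_lt (one_div_le_one_div_of_le (by positivity) ?_) hj
    exact_mod_cast hjm
  -- Masses are rounded down to multiples of `1 / K`; the errors over all cylinders then add up to
  -- at most `1 / m`.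
  set K : ℕ := Fintype.card (Fin m → Bool) * m with hK
  have hc : 0 < Fintype.card (Fin m → Bool) := Fintype.card_pos
  have hK0 : (0 : ℝ) < K := by rw [hK]; exact_mod_cast Nat.mul_pos hc (Nat.pos_of_ne_zero hm0)
  let mass : ProhorovSpace CantorSpace → (Fin m → Bool) → ℝ := fun μ v =>
    (μ.toMeasure : Measure CantorSpace).real (initialSegment m ⁻¹' {v})
  have mass_floor : ∀ μ v, ⌊K * mass μ v⌋₊ < K + 1 := fun μ v => by
    refine Nat.lt_succ_of_le (Nat.floor_le_of_le ?_)
    exact mul_le_of_le_one_right hK0.le measureReal_le_one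
  let q : ProhorovSpace CantorSpace → (Fin m → Bool) → Fin (K + 1) := fun μ v =>
    ⟨⌊K * mass μ v⌋₊, mass_floor μ v⟩
  refine ⟨Fintype.card ((Fin m → Bool) → Fin (K + 1)), fun n => iSup_le fun A => ?_⟩
  have hinj : Set.InjOn q A.1 := by
    intro μ hμ ν hν hq
    by_contra hne
    refine absurd (A.2 μ hμ ν hν hne) (not_le.2 (lt_of_le_of_lt ?_ hmε))
    -- For `n = 0` the supremum is the default value `0`, so the bound must be nonnegative.
    refine Real.iSup_le (fun k => ?_) (by positivity)
    refine dist_inducedMap_iterate_le hm0 hm (η := 1 / K) (by positivity) ?_ (fun v => ?_) k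
    · rw [hK]; push_cast
      have : (Fintype.card (Fin m → Bool) : ℝ) ≠ 0 := by exact_mod_cast hc.ne'
      have : (m : ℝ) ≠ 0 := by exact_mod_cast hm0
      apply le_of_eq
      field_simp
    · have hv : ⌊K * mass μ v⌋₊ = ⌊K * mass ν v⌋₊ := congrArg Fin.val (congrFun hq v)
      have h1 : K * mass μ v < ⌊K * mass μ v⌋₊ + 1 := Nat.lt_floor_add_one _
      have h2 : (⌊K * mass ν v⌋₊ : ℝ) ≤ K * mass ν v :=
        Nat.floor_le (mul_nonneg hK0.le measureReal_nonneg)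
      rw [hv] at h1
      change mass μ v ≤ mass ν v + 1 / K
      rw [← sub_le_iff_le_add', le_div_iff₀ hK0]
      linarith
  rw [← hinj.encard_image, ← ENat.card_eq_coe_fintype_card, ← Set.encard_univ]
  exact Set.encard_le_encard (Set.subset_univ _)

/-! ### Bounded separated sets give zero entropy -/

theorem one_le_maxSeparated {X : Type*} [MetricSpace X] [Nonempty X] (T : X → X) (n : ℕ) (ε : ℝ) :
    1 ≤ maxSeparated T n ε := by
  obtain ⟨x⟩ := ‹Nonempty X›
  have hx : IsSeparatedSet T n ε {x} := by
    rintro y rfl z rfl h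
    exact absurd rfl h
  calc (1 : ℕ∞) = ({x} : Set X).encard := (Set.encard_singleton x).symm
    _ ≤ _ := le_iSup (fun B : {B : Set X // IsSeparatedSet T n ε B} => B.1.encard) ⟨{x}, hx⟩

/-- The quotients lie between `0` and `log C / n`. Nonemptiness matters: it excludes `log 0 = ⊥`. -/
theorem separatedGrowth_eq_zero {X : Type*} [MetricSpace X] [Nonempty X] {T : X → X} {ε : ℝ}
    {C : ℕ} (hC : ∀ n, maxSeparated T n ε ≤ C) : separatedGrowth T ε = 0 := by
  have hC1 : 1 ≤ C := by exact_mod_cast (one_le_maxSeparated T 0 ε).trans (hC 0)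
  have hlim : Tendsto (fun n : ℕ => ENNReal.log (C : ENNReal) / (n : EReal)) atTop (𝓝 0) := by
    refine EReal.tendsto_const_div_atTop_nhds_zero_nat ?_ ?_
    · simpa using Nat.one_le_iff_ne_zero.1 hC1
    · simp
  refine Tendsto.limsup_eq (tendsto_of_tendsto_of_tendsto_of_le_of_le tendsto_const_nhds hlim
    (fun n => ?_) fun n => ?_)
  · refine EReal.div_nonneg ?_ (by positivity)
    rw [ENNReal.zero_le_log_iff]
    exact_mod_cast one_le_maxSeparated T n ε
  · refine EReal.div_le_div_right_of_nonneg (by positivity) (ENNReal.log_monotone ?_)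
    exact_mod_cast hC n

theorem topEntropy_eq_zero_of_bounded {X : Type*} [MetricSpace X] [Nonempty X] {T : X → X}
    (h : ∀ ε > 0, ∃ C : ℕ, ∀ n, maxSeparated T n ε ≤ C) : topEntropy T = 0 := by
  refine tendsto_nhds_unique (tendsto_topEntropy T) (tendsto_const_nhds.congr' ?_)
  filter_upwards [self_mem_nhdsWithin] with ε hε
  obtain ⟨C, hC⟩ := h ε hε
  exact (separatedGrowth_eq_zero hC).symm

end CantorEntropy

/-- For the generic continuous self-map `f` of the Cantor space (all `f` outside a set of the first
category in the space of continuous self-maps, with the topology of uniform convergence), the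
induced map on the space of Borel probability measures has zero topological entropy. -/
theorem corollary3p6 :
    IsMeagre {f : C(CantorEntropy.CantorSpace, CantorEntropy.CantorSpace) |
      ¬ CantorEntropy.topEntropy (CantorEntropy.inducedMap f) = 0} := by
  rw [IsMeagre]
  refine mem_of_superset CantorEntropy.residual_preservesInitialSegments fun f hf => ?_
  have : Nonempty (CantorEntropy.ProhorovSpace CantorEntropy.CantorSpace) :=
    ⟨LevyProkhorov.ofMeasure ⟨Measure.dirac (CantorEntropy.CantorSpace.extend 0 Fin.elim0), inferInstance⟩⟩
  simpa using CantorEntropy.topEntropy_eq_zero_of_bounded fun ε hε =>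
    CantorEntropy.exists_maxSeparated_inducedMap_le hf hε
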